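/- Let $C_I, C_{SI}, C_{SG} > 0$. There exist constants $C > 1$ and $\gamma, \tau, \nu > 0$, depending only on $C_I, C_{SI}, C_{SG}$, such that the following holds for all $n, m \in \mathbb{N}$ with $m \ge C n$. Let $a_1, \dots, a_m$ be independent, identically distributed random vectors in $\mathbb{C}^n$ whose common distribution satisfies, for $\alpha$ distributed as $a_1$, 1. (isotropy) $\mathbb{E}\,|\langle \alpha, z\rangle|^2 = C_I \|z\|_{\ell_2}^2$ for all $z \in \mathbb{C}^n$; 2. (sub-isotropy) $\mathbb{E}\,\langle \alpha | Z | \alpha\rangle^2 \ge C_{SI} \|Z\|_2^2$ for all Hermitian $Z \in \mathbb{C}^{n\times n}$; 3. (sub-Gaussian tails) $\mathbb{E}\,|\langle \alpha, z\rangle|^{2N} \le C_{SG}\, N!$ for all $z \in \mathbb{C}^n$ with $\|z\|_{\ell_2} = 1$ and all integers $N \ge 1$. Here $\|Z\|_2 = \sqrt{\operatorname{tr}(Z Z^\dagger)}$ is the Frobenius norm. Put $A_k = |a_k\rangle\langle a_k|$ and $\mathcal{A}(Z) = (\operatorname{tr}(A_k Z))_{k=1}^m = (\langle a_k | Z | a_k\rangle)_{k=1}^m$,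 let $\mathcal{B}_1 = \operatorname{conv}\{\pm |x\rangle\langle x| : x \in \mathbb{C}^n, \|x\|_{\ell_2} = 1\}$ be the trace-norm unit ball of Hermitian matrices, and let $D = \{Z \in \mathbb{C}^{n \times n} \text{ Hermitian} : \|Z\|_2 = 1\} \cap 3\mathcal{B}_1$. Then, with probability at least $1 - 3 e^{-\gamma m}$, both $$\frac{\tau}{m}\, \|\mathcal{A}(Z)\|_{\ell_1} \ge \|Z\|_2 \quad \text{for all } Z \in D$$ and $$\Big\| \frac{1}{\nu m} \sum_{k=1}^m A_k - \mathbb{I} \Big\|_\infty \le \frac16,$$ where $\|\cdot\|_\infty$ denotes the operator norm. -/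

import Mathlib

open MeasureTheory ProbabilityTheory
open scoped Pointwise Matrix Nat

namespace PhaseRetrieval

noncomputable section

/-- The rank-one matrix `|x⟩⟨x|`, with entries `x i * conj (x j)`. -/
def ketbra {n : ℕ} (x : EuclideanSpace ℂ (Fin n)) : Matrix (Fin n) (Fin n) ℂ :=
  Matrix.of fun i j => x i * star (x j)

/-- The Frobenius (Hilbert-Schmidt) norm, `‖Z‖₂ = √(tr (Z Z†))`. -/
def frobNorm {n : ℕ} (Z : Matrix (Fin n) (Fin n) ℂ) : ℝ :=
  √((Z * Zᴴ).trace).re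

/-- The operator (spectral) norm `‖M‖_∞`, with respect to the Euclidean norm on `ℂⁿ`. -/
def opNorm {n : ℕ} (M : Matrix (Fin n) (Fin n) ℂ) : ℝ :=
  ‖Matrix.toEuclideanCLM (n := Fin n) (𝕜 := ℂ) M‖

/-- The Frobenius unit sphere in the real space of Hermitian matrices. -/
def frobSphere (n : ℕ) : Set (Matrix (Fin n) (Fin n) ℂ) :=
  {Z | Z.IsHermitian ∧ frobNorm Z = 1}

/-- The trace-norm unit ball in the real space of Hermitian matrices: the (real) convex hull of
the matrices `± |x⟩⟨x|` with `x` in the complex unit sphere. -/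
def traceBall (n : ℕ) : Set (Matrix (Fin n) (Fin n) ℂ) :=
  convexHull ℝ {Z | ∃ x : EuclideanSpace ℂ (Fin n), ‖x‖ = 1 ∧ (Z = ketbra x ∨ Z = -ketbra x)}

/-- `D`: the Frobenius unit sphere intersected with three times the trace-norm ball. -/
def testSet (n : ℕ) : Set (Matrix (Fin n) (Fin n) ℂ) :=
  frobSphere n ∩ (3 : ℝ) • traceBall n

/-- The measurement operator `𝒜(Z) = ∑ k, tr (A k * Z) e_k`. The traces are real for Hermitian
`A k` and `Z`; taking the real part only makes the values real numbers. -/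
def measurementOp {n m : ℕ} (A : Fin m → Matrix (Fin n) (Fin n) ℂ)
    (Z : Matrix (Fin n) (Fin n) ℂ) : Fin m → ℝ :=
  fun k => ((A k * Z).trace).re

/-- The lower bound `(τ / m) ‖𝒜(Z)‖_{ℓ¹} ≥ ‖Z‖₂` for all `Z ∈ D`. -/
def L1LowerBound {n m : ℕ} (τ : ℝ) (A : Fin m → Matrix (Fin n) (Fin n) ℂ) : Prop :=
  ∀ Z ∈ testSet n, frobNorm Z ≤ τ / m * ∑ k, |measurementOp A Z k|

/-- The condition `‖(1 / (ν m)) ∑ k, A k - 𝕀‖_∞ ≤ 1 / 6`. -/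
def FrameNearIdentity {n m : ℕ} (ν : ℝ) (A : Fin m → Matrix (Fin n) (Fin n) ℂ) : Prop :=
  opNorm (((1 / (ν * m) : ℝ) : ℂ) • ∑ k, A k - 1) ≤ 1 / 6

/-- Isotropy on `ℂⁿ`: `𝔼 |⟨α, z⟩|² = C_I ‖z‖²` for all `z`. -/
def Isotropic {n : ℕ} (ρ : Measure (EuclideanSpace ℂ (Fin n))) (CI : ℝ) : Prop :=
  ∀ z : EuclideanSpace ℂ (Fin n), ∫ α, ‖inner ℂ α z‖ ^ 2 ∂ρ = CI * ‖z‖ ^ 2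

/-- Sub-isotropy on Hermitian matrices: `𝔼 ⟨α|Z|α⟩² ≥ C_SI ‖Z‖₂²` for all Hermitian `Z`.
For Hermitian `Z` the number `⟨α|Z|α⟩` is real. -/
def SubIsotropic {n : ℕ} (ρ : Measure (EuclideanSpace ℂ (Fin n))) (CSI : ℝ) : Prop :=
  ∀ Z : Matrix (Fin n) (Fin n) ℂ, Z.IsHermitian →
    CSI * frobNorm Z ^ 2 ≤
      ∫ α, (inner ℂ α (Matrix.toEuclideanCLM (n := Fin n) (𝕜 := ℂ) Z α)).re ^ 2 ∂ρ

/-- Sub-Gaussian tails: `𝔼 |⟨α, z⟩|^(2 N) ≤ C_SG N!` (in particular the moment is finite) for all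
unit vectors `z` and all `N ≥ 1`. -/
def SubGaussianMoments {n : ℕ} (ρ : Measure (EuclideanSpace ℂ (Fin n))) (CSG : ℝ) : Prop :=
  ∀ z : EuclideanSpace ℂ (Fin n), ‖z‖ = 1 → ∀ N : ℕ, 1 ≤ N →
    Integrable (fun α => ‖inner ℂ α z‖ ^ (2 * N)) ρ ∧
      ∫ α, ‖inner ℂ α z‖ ^ (2 * N) ∂ρ ≤ CSG * (N ! : ℝ)

end

end PhaseRetrieval

/-! Both events are Chernoff bounds for sums of `|a_k⟩⟨a_k|`, with a net controlling operator norms.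
Each fails with probability at most `2 * 25 ^ n * exp (-κ m)`, and `m ≥ C n` absorbs the entropy
factor `25 ^ n`.

Frame bound (`measure_not_frameNearIdentity_le`): the moments `C_SG N!` make `|⟨α, y⟩|²`
sub-exponential with mean `C_I` for each unit `y`, so `ν = C_I`; a union bound over the net
finishes.

Lower bound on `D` (`measure_not_l1LowerBound_le`): fourth moments on the trace ball are bounded,
since `t ↦ t ^ 4` is convex, so sub-isotropy forces `𝔼 |⟨α|Z|α⟩| ≥ μ₀` uniformly on `D`
(`le_integral_abs_quadForm`). Simultaneous concentration is obtained at the level of exponential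
moments of suprema. `lintegral_pi_symmetrization` replaces the centred sums of `|⟨a_k|Z|a_k⟩|` by
the linear process `∑ ε_k ⟨a_k|Z|a_k⟩` with random signs. As `D` lies in three trace-norm balls,
duality bounds this process by `3 ‖∑ ε_k A_k‖_∞`, which the net reduces again to scalar exponential
moments (`lintegral_signed_iSup_le`). -/

namespace PhaseRetrieval

/-! ### Quadratic forms and rank-one matrices -/

/-- The real quadratic form `x ↦ Re ⟨x, Z x⟩` of a complex matrix, as a linear map in `Z`. -/
noncomputable def quadForm {n : ℕ} (x : EuclideanSpace ℂ (Fin n)) :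
    Matrix (Fin n) (Fin n) ℂ →ₗ[ℝ] ℝ where
  toFun Z := (inner ℂ x (Matrix.toEuclideanCLM (n := Fin n) (𝕜 := ℂ) Z x)).re
  map_add' Z W := by simp
  map_smul' r Z := by
    have : (r • Z : Matrix (Fin n) (Fin n) ℂ) = (r : ℂ) • Z := by
      ext i j; simp
    rw [this, map_smul]
    simp

lemma quadForm_apply {n : ℕ} (x : EuclideanSpace ℂ (Fin n)) (Z : Matrix (Fin n) (Fin n) ℂ) :
    quadForm x Z = (inner ℂ x (Matrix.toEuclideanCLM (n := Fin n) (𝕜 := ℂ) Z x)).re := rfl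

lemma re_trace_ketbra_mul {n : ℕ} (x : EuclideanSpace ℂ (Fin n)) (Z : Matrix (Fin n) (Fin n) ℂ) :
    ((ketbra x * Z).trace).re = quadForm x Z := by
  rw [quadForm_apply, PiLp.inner_apply]
  congr 1
  simp only [Matrix.trace, Matrix.diag, Matrix.mul_apply, ketbra, Matrix.of_apply,
    Matrix.ofLp_toEuclideanCLM, Matrix.mulVec, dotProduct, RCLike.inner_apply, Finset.sum_mul]
  rw [Finset.sum_comm]
  refine Finset.sum_congr rfl fun i _ => Finset.sum_congr rfl fun j _ => ?_
  simp only [RCLike.star_def]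
  ring

lemma toEuclideanCLM_ketbra {n : ℕ} (a x : EuclideanSpace ℂ (Fin n)) :
    Matrix.toEuclideanCLM (n := Fin n) (𝕜 := ℂ) (ketbra a) x = inner ℂ a x • a := by
  ext i
  simp only [Matrix.ofLp_toEuclideanCLM, Matrix.mulVec, dotProduct, ketbra, Matrix.of_apply,
    PiLp.smul_apply, smul_eq_mul, PiLp.inner_apply, RCLike.inner_apply, Finset.sum_mul]
  refine Finset.sum_congr rfl fun j _ => ?_
  simp only [RCLike.star_def]
  ring

lemma quadForm_ketbra {n : ℕ} (a x : EuclideanSpace ℂ (Fin n)) :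
    quadForm x (ketbra a) = ‖(inner ℂ a x : ℂ)‖ ^ 2 := by
  rw [quadForm_apply, toEuclideanCLM_ketbra, inner_smul_right, ← inner_conj_symm x a,
    Complex.mul_conj, Complex.ofReal_re, Complex.normSq_eq_norm_sq]

lemma quadForm_one {n : ℕ} (x : EuclideanSpace ℂ (Fin n)) :
    quadForm x (1 : Matrix (Fin n) (Fin n) ℂ) = ‖x‖ ^ 2 := by
  rw [quadForm_apply, map_one, one_apply_eq_self, inner_self_eq_norm_sq_to_K]
  norm_cast

lemma isHermitian_ketbra {n : ℕ} (x : EuclideanSpace ℂ (Fin n)) : (ketbra x).IsHermitian := by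
  ext i j
  simp [ketbra, mul_comm]

lemma continuous_quadForm_left {n : ℕ} (Z : Matrix (Fin n) (Fin n) ℂ) :
    Continuous fun x : EuclideanSpace ℂ (Fin n) => quadForm x Z := by
  simp only [quadForm_apply]
  fun_prop

lemma continuous_quadForm_right {n : ℕ} (x : EuclideanSpace ℂ (Fin n)) :
    Continuous fun Z : Matrix (Fin n) (Fin n) ℂ => quadForm x Z :=
  (quadForm x).continuous_of_finiteDimensional

/-! ### Nets, operator norm and trace-norm duality -/

/-- A finite `1/2`-net of the unit sphere of `ℂⁿ` with at most `25 ^ n` points. -/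
lemma exists_half_net (n : ℕ) : ∃ N : Finset (EuclideanSpace ℂ (Fin n)),
    N.card ≤ 25 ^ n ∧ (∀ y ∈ N, ‖y‖ = 1) ∧
      ∀ x : EuclideanSpace ℂ (Fin n), ‖x‖ = 1 → ∃ y ∈ N, ‖x - y‖ ≤ 1 / 2 := by
  classical
  let E := EuclideanSpace ℂ (Fin n)
  let Q : Finset E → Prop := fun s =>
    (∀ y ∈ s, ‖y‖ = 1) ∧ ∀ c ∈ s, ∀ d ∈ s, c ≠ d → 1 / 2 ≤ ‖c - d‖
  have hcard : ∀ s, Q s → s.card ≤ 25 ^ n := by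
    intro s hs
    -- Doubling gives a 1-separated set in the ball of radius 2, hence at most `5 ^ d` points, where
    -- `d = 2 n` is the real dimension.
    have h := Besicovitch.card_le_of_separated (E := E) (s.image fun x => (2 : ℝ) • x) ?_ ?_
    · rw [Finset.card_image_of_injective _ (smul_right_injective E (two_ne_zero)),
        finrank_real_of_complex, finrank_euclideanSpace_fin, pow_mul] at h
      norm_num at h
      exact h
    · intro c hc
      obtain ⟨y, hy, rfl⟩ := Finset.mem_image.1 hc
      rw [norm_smul, hs.1 y hy]; norm_num
    · intro c hc d hd hcd
      obtain ⟨y, hy, rfl⟩ := Finset.mem_image.1 hc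
      obtain ⟨z, hz, rfl⟩ := Finset.mem_image.1 hd
      have := hs.2 y hy z hz (fun h => hcd (by rw [h]))
      rw [← smul_sub, norm_smul]
      norm_num
      linarith
  -- A separated set of maximal cardinality is a net: a point far from all of it could be added.
  let S : Set ℕ := {k | ∃ s, Q s ∧ s.card = k}
  have hne : S.Nonempty := ⟨0, ∅, ⟨by simp, by simp⟩, rfl⟩
  have hbdd : BddAbove S := ⟨25 ^ n, by rintro k ⟨s, hs, rfl⟩; exact hcard s hs⟩
  obtain ⟨N, hN, hNk⟩ := Nat.sSup_mem hne hbdd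
  refine ⟨N, hcard N hN, hN.1, fun x hx => ?_⟩
  by_contra! hcon
  have hxN : x ∉ N := fun h => by have := hcon x h; norm_num at this
  have hQ : Q (insert x N) := by
    refine ⟨?_, ?_⟩
    · intro y hy
      rcases Finset.mem_insert.1 hy with rfl | hy
      exacts [hx, hN.1 y hy]
    · intro c hc d hd hcd
      rcases Finset.mem_insert.1 hc with hc | hc <;> rcases Finset.mem_insert.1 hd with hd | hd
      · exact absurd (hc.trans hd.symm) hcd
      · rw [hc]; exact (hcon d hd).le
      · rw [hd, norm_sub_rev]; exact (hcon c hc).le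
      · exact hN.2 c hc d hd hcd
  have := le_csSup hbdd ⟨_, hQ, rfl⟩
  rw [Finset.card_insert_of_notMem hxN, hNk] at this
  omega

lemma quadForm_abs_le_opNorm {n : ℕ} (M : Matrix (Fin n) (Fin n) ℂ)
    {x : EuclideanSpace ℂ (Fin n)} (hx : ‖x‖ = 1) : |quadForm x M| ≤ opNorm M := by
  rw [quadForm_apply]
  refine (Complex.abs_re_le_norm _).trans ((norm_inner_le_norm _ _).trans ?_)
  have := (Matrix.toEuclideanCLM (n := Fin n) (𝕜 := ℂ) M).le_opNorm x
  rw [hx, mul_one] at this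
  rw [hx, one_mul]
  exact this

lemma isSymmetric_toEuclideanCLM {n : ℕ} {M : Matrix (Fin n) (Fin n) ℂ} (hM : M.IsHermitian) :
    (Matrix.toEuclideanCLM (n := Fin n) (𝕜 := ℂ) M).IsSymmetric := by
  have h : IsSelfAdjoint (Matrix.toEuclideanCLM (n := Fin n) (𝕜 := ℂ) M) :=
    IsSelfAdjoint.map hM _
  exact h.isSymmetric

/-- The operator norm of a Hermitian matrix is controlled by its quadratic form on a
`1/2`-net of the sphere. -/
lemma opNorm_le_of_net {n : ℕ} {M : Matrix (Fin n) (Fin n) ℂ} (hM : M.IsHermitian)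
    {N : Finset (EuclideanSpace ℂ (Fin n))}  (hN : ∀ y ∈ N, ‖y‖ = 1)
    (hnet : ∀ x : EuclideanSpace ℂ (Fin n), ‖x‖ = 1 → ∃ y ∈ N, ‖x - y‖ ≤ 1 / 2)
    {b : ℝ} (hb0 : 0 ≤ b) (hb : ∀ y ∈ N, |quadForm y M| ≤ b) : opNorm M ≤ 34 * b := by
  set T := Matrix.toEuclideanCLM (n := Fin n) (𝕜 := ℂ) M with hT
  have hsym := isSymmetric_toEuclideanCLM hM
  rw [← hT] at hsym
  have key : ∀ x : EuclideanSpace ℂ (Fin n), ‖x‖ = 1 →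
      |quadForm x M| ≤ b + 33 / 34 * opNorm M := by
    intro x hx
    obtain ⟨y, hy, hxy⟩ := hnet x hx
    have hy1 := hN y hy
    have hdiff : quadForm x M - quadForm y M = (inner ℂ (x - y) (T (x + y))).re := by
      have h1 : (inner ℂ y (T x) : ℂ).re = (inner ℂ x (T y)).re := by
        rw [← inner_conj_symm, Complex.conj_re]
        congr 1
        exact hsym x y
      simp only [quadForm_apply, map_add, inner_add_right, inner_sub_left, ← hT,
        Complex.add_re, Complex.sub_re, h1]
      ring
    have hpar := parallelogram_law_with_norm ℂ x y
    rw [hx, hy1] at hpar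
    -- With `u = ‖x - y‖² ≤ 1/4`, the parallelogram law gives `u (4 - u) ≤ 15/16 < (33/34)²`. The
    -- factor below 1 is what lets a net as coarse as `1/2` suffice.
    have hprod : ‖x - y‖ * ‖x + y‖ ≤ 33 / 34 := by
      have h0 := norm_nonneg (x - y)
      have hu : ‖x - y‖ ^ 2 ≤ 1 / 4 := by nlinarith
      refine abs_le_of_sq_le_sq' ?_ (by norm_num) |>.2
      have : (‖x - y‖ * ‖x + y‖) ^ 2 = ‖x - y‖ ^ 2 * (4 - ‖x - y‖ ^ 2) := by
        rw [mul_pow]; congr 1; linarith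
      rw [this]
      nlinarith
    have hbound : |(inner ℂ (x - y) (T (x + y))).re| ≤ 33 / 34 * opNorm M := by
      refine (Complex.abs_re_le_norm _).trans ((norm_inner_le_norm _ _).trans ?_)
      have hop : ‖T (x + y)‖ ≤ opNorm M * ‖x + y‖ := T.le_opNorm (x + y)
      have hnn : 0 ≤ opNorm M := norm_nonneg T
      calc ‖x - y‖ * ‖T (x + y)‖ ≤ ‖x - y‖ * (opNorm M * ‖x + y‖) := by gcongr
        _ = (‖x - y‖ * ‖x + y‖) * opNorm M := by ring
        _ ≤ _ := by gcongr
    have := hb y hy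
    calc |quadForm x M| = |quadForm y M + (quadForm x M - quadForm y M)| := by ring_nf
      _ ≤ _ := (abs_add_le _ _).trans (add_le_add this (hdiff ▸ hbound))
  have hop0 : 0 ≤ opNorm M := norm_nonneg T
  -- For a symmetric operator the norm is the supremum of the absolute Rayleigh quotients.
  have : opNorm M ≤ b + 33 / 34 * opNorm M := by
    conv_lhs => rw [opNorm, ← hT, T.norm_eq_iSup_rayleighQuotient hsym]
    refine ciSup_le fun x => ?_
    rcases eq_or_ne x 0 with rfl | hx
    · simp; positivity
    · have hx' : ‖x‖ ≠ 0 := norm_ne_zero_iff.2 hx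
      have hr : T.rayleighQuotient x = T.rayleighQuotient (((‖x‖⁻¹ : ℝ) : ℂ) • x) :=
        (T.rayleigh_smul x (by simpa using hx)).symm
      have hn : ‖((‖x‖⁻¹ : ℝ) : ℂ) • x‖ = 1 := by
        rw [norm_smul]; simp [hx']
      rw [hr, ContinuousLinearMap.rayleighQuotient, hn,
        ContinuousLinearMap.reApplyInnerSelf_apply]
      have := key _ hn
      rw [quadForm_apply, ← inner_conj_symm, Complex.conj_re] at this
      simpa using this
  linarith

/-- A linear functional bounded on the `± |x⟩⟨x|` is bounded by three times as much on `D`. -/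
lemma abs_le_of_mem_testSet {n : ℕ} {Z : Matrix (Fin n) (Fin n) ℂ} (hZ : Z ∈ testSet n)
    (f : Matrix (Fin n) (Fin n) ℂ →ₗ[ℝ] ℝ) {b : ℝ}
    (hf : ∀ x : EuclideanSpace ℂ (Fin n), ‖x‖ = 1 → |f (ketbra x)| ≤ b) : |f Z| ≤ 3 * b := by
  obtain ⟨W, hW, rfl⟩ := hZ.2
  have hsub : traceBall n ⊆ f ⁻¹' (Set.Icc (-b) b) := by
    refine convexHull_min ?_ ((convex_Icc _ _).linear_preimage f)
    rintro _ ⟨x, hx, rfl | rfl⟩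
    · exact abs_le.1 (hf x hx)
    · have := abs_le.1 (hf x hx)
      simp only [Set.mem_preimage, map_neg, Set.mem_Icc]
      constructor <;> linarith
  have := abs_le.2 (hsub hW)
  rw [map_smul, smul_eq_mul, abs_mul]
  norm_num
  exact this

/-! ### Symmetrization and contraction for exponential moments -/

/-- For indices `i`, `j` attached to the two left-hand suprema, the sign of `t i` decides which
right-hand supremum absorbs the `i` term; the other absorbs the `j` term because `-|t j|` is below
both `t j` and `-t j`. This removes absolute values with no loss of constant. -/
lemma iSup_contraction {J : Type*} (h t : J → ℝ) :
    (⨆ j, ENNReal.ofReal (Real.exp (h j + |t j|))) + (⨆ j, ENNReal.ofReal (Real.exp (h j - |t j|)))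
      ≤ (⨆ j, ENNReal.ofReal (Real.exp (h j + t j)))
        + ⨆ j, ENNReal.ofReal (Real.exp (h j - t j)) := by
  rcases isEmpty_or_nonempty J with hJ | hJ
  · simp
  have hle : ∀ (g g' : J → ℝ) (i : J), g i ≤ g' i →
      ENNReal.ofReal (Real.exp (g i)) ≤ ⨆ j, ENNReal.ofReal (Real.exp (g' j)) := fun g g' i hi =>
    le_iSup_of_le i (ENNReal.ofReal_le_ofReal (Real.exp_le_exp.2 hi))
  refine ENNReal.iSup_add_iSup_le fun i j => ?_
  rcases le_total 0 (t i) with hi | hi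
  · refine add_le_add (hle (fun j => h j + |t j|) (fun j => h j + t j) i ?_)
      (hle (fun j => h j - |t j|) (fun j => h j - t j) j ?_)
    · simp [abs_of_nonneg hi]
    · linarith [le_abs_self (t j)]
  · rw [add_comm (⨆ j, ENNReal.ofReal (Real.exp (h j + t j)))]
    refine add_le_add (hle (fun j => h j + |t j|) (fun j => h j - t j) i ?_)
      (hle (fun j => h j - |t j|) (fun j => h j + t j) j ?_)
    · simp [abs_of_nonpos hi, sub_eq_add_neg]
    · linarith [neg_abs_le (t j)]

/-- Jensen via the tangent line at the mean, which is integrable even when `exp ∘ g` is not; the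
right side may be infinite. -/
lemma exp_integral_le_lintegral {E : Type*} [MeasurableSpace E] {ρ : Measure E}
    [IsProbabilityMeasure ρ] {g : E → ℝ} (hg : Integrable g ρ) :
    ENNReal.ofReal (Real.exp (∫ x, g x ∂ρ)) ≤ ∫⁻ x, ENNReal.ofReal (Real.exp (g x)) ∂ρ := by
  set c := ∫ x, g x ∂ρ with hc
  have hint : Integrable (fun x => Real.exp c * (1 + (g x - c))) ρ :=
    ((integrable_const _).add (hg.sub (integrable_const _))).const_mul _
  have heq : ∫ x, Real.exp c * (1 + (g x - c)) ∂ρ = Real.exp c := by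
    have hsub : Integrable (fun x => g x - c) ρ := hg.sub (integrable_const _)
    rw [integral_const_mul, integral_add (integrable_const _) hsub,
      integral_sub hg (integrable_const _)]
    simp [← hc]
  rw [← heq]
  have hle : ∫ x, Real.exp c * (1 + (g x - c)) ∂ρ ≤
      (∫⁻ x, ENNReal.ofReal (Real.exp c * (1 + (g x - c))) ∂ρ).toReal := by
    rw [integral_eq_lintegral_pos_part_sub_lintegral_neg_part hint]
    exact sub_le_self _ ENNReal.toReal_nonneg
  refine ((ENNReal.ofReal_le_ofReal hle).trans ENNReal.ofReal_toReal_le).trans ?_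
  refine lintegral_mono fun x => ENNReal.ofReal_le_ofReal ?_
  calc Real.exp c * (1 + (g x - c)) ≤ Real.exp c * Real.exp (g x - c) := by
        gcongr
        linarith [Real.add_one_le_exp (g x - c)]
    _ = Real.exp (g x) := by rw [← Real.exp_add]; ring_nf

/-- One coordinate of symmetrization and contraction, for exponential moments of suprema. -/
lemma lintegral_iSup_exp_le {J E : Type*} [Countable J] [MeasurableSpace E] (ρ : Measure E)
    [IsProbabilityMeasure ρ] (f : J → E → ℝ) (hm : ∀ j, Measurable (f j))
    (hf : ∀ j, Integrable (f j) ρ) (l : ℝ) (hl : 0 ≤ l) (h : J → ℝ) :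
    ∫⁻ x, ⨆ j, ENNReal.ofReal (Real.exp (h j + l * (∫ y, |f j y| ∂ρ - |f j x|))) ∂ρ ≤
      2⁻¹ * (∫⁻ x, (⨆ j, ENNReal.ofReal (Real.exp (h j + 2 * l * f j x))) ∂ρ
        + ∫⁻ x, ⨆ j, ENNReal.ofReal (Real.exp (h j - 2 * l * f j x)) ∂ρ) := by
  have hmeas : ∀ c : ℝ, Measurable fun x => ⨆ j, ENNReal.ofReal (Real.exp (h j + c * |f j x|)) :=
    fun c => .iSup fun j => by have := hm j; fun_prop
  have hmeas' : ∀ c : ℝ, Measurable fun x => ⨆ j, ENNReal.ofReal (Real.exp (h j + c * f j x)) :=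
    fun c => .iSup fun j => by have := hm j; fun_prop
  set A : E → ENNReal := fun x => ⨆ j, ENNReal.ofReal (Real.exp (h j + 2 * l * |f j x|)) with hA
  set B : E → ENNReal := fun x => ⨆ j, ENNReal.ofReal (Real.exp (h j + -(2 * l) * |f j x|))
    with hB
  have hAm : Measurable A := hmeas _
  have hBm : Measurable B := hmeas _
  have step1 : ∀ x, (⨆ j, ENNReal.ofReal (Real.exp (h j + l * (∫ y, |f j y| ∂ρ - |f j x|)))) ≤
      ∫⁻ y, 2⁻¹ * (A y + B x) ∂ρ := by
    intro x
    refine iSup_le fun j => ?_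
    have hi : Integrable (fun y => h j + l * (|f j y| - |f j x|)) ρ :=
      (integrable_const _).add (((hf j).abs.sub (integrable_const _)).const_mul _)
    have e : h j + l * (∫ y, |f j y| ∂ρ - |f j x|) = ∫ y, (h j + l * (|f j y| - |f j x|)) ∂ρ := by
      have hsub : Integrable (fun y => |f j y| - |f j x|) ρ := (hf j).abs.sub (integrable_const _)
      rw [integral_add (integrable_const _) (hsub.const_mul _), integral_const_mul, integral_sub (hf j).abs (integrable_const _)]
      simp
    rw [e]
    refine (exp_integral_le_lintegral hi).trans (lintegral_mono fun y => ?_)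
    -- Midpoint convexity separates `x` from its independent copy `y`, so the two suprema can be
    -- taken independently; this costs the factor 2 in `2 * l`.
    have hconv : Real.exp (h j + l * (|f j y| - |f j x|)) ≤
        2⁻¹ * (Real.exp (h j + 2 * l * |f j y|) + Real.exp (h j + -(2 * l) * |f j x|)) := by
      have := convexOn_exp.2 (Set.mem_univ (h j + 2 * l * |f j y|))
        (Set.mem_univ (h j + -(2 * l) * |f j x|))
        (by norm_num : (0 : ℝ) ≤ 2⁻¹) (by norm_num : (0 : ℝ) ≤ 2⁻¹) (by norm_num)
      simp only [smul_eq_mul] at this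
      rw [mul_add]
      refine le_trans (le_of_eq ?_) this
      congr 1
      ring
    refine (ENNReal.ofReal_le_ofReal hconv).trans ?_
    rw [ENNReal.ofReal_mul (by norm_num), ENNReal.ofReal_add (Real.exp_pos _).le (Real.exp_pos _).le,
      ENNReal.ofReal_inv_of_pos two_pos, ENNReal.ofReal_ofNat]
    gcongr
    · exact le_iSup (fun j => ENNReal.ofReal (Real.exp (h j + 2 * l * |f j y|))) j
    · exact le_iSup (fun j => ENNReal.ofReal (Real.exp (h j + -(2 * l) * |f j x|))) j
  calc _ ≤ ∫⁻ x, ∫⁻ y, 2⁻¹ * (A y + B x) ∂ρ ∂ρ := lintegral_mono step1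
    _ = 2⁻¹ * (∫⁻ x, A x ∂ρ + ∫⁻ x, B x ∂ρ) := by
        have : ∀ x, ∫⁻ y, 2⁻¹ * (A y + B x) ∂ρ = 2⁻¹ * (∫⁻ y, A y ∂ρ + B x) := by
          intro x
          rw [lintegral_const_mul _ (by fun_prop), lintegral_add_left hAm, lintegral_const, measure_univ, mul_one]
        simp_rw [this]
        rw [lintegral_const_mul _ (by fun_prop),
          lintegral_add_left measurable_const, lintegral_const, measure_univ, mul_one]
    _ ≤ _ := by
        rw [← lintegral_add_left hAm]
        have hm2 := hmeas' (2 * l)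
        rw [← lintegral_add_left hm2]
        refine mul_le_mul_right (lintegral_mono fun x => ?_) _
        have := iSup_contraction h (fun j => 2 * l * f j x)
        simpa [hA, hB, abs_mul, abs_of_nonneg hl, sub_eq_add_neg] using this

/-- The law of `(ε, x)` with `ε` a random sign independent of `x ∼ ρ`. -/
noncomputable def signedMeasure {E : Type*} [MeasurableSpace E] (ρ : Measure E) :
    Measure (ℝ × E) :=
  (2⁻¹ : ENNReal) • (ρ.map (fun x => ((1 : ℝ), x)) + ρ.map (fun x => ((-1 : ℝ), x)))

lemma lintegral_signedMeasure {E : Type*} [MeasurableSpace E] (ρ : Measure E)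
    {g : ℝ × E → ENNReal} (hg : Measurable g) :
    ∫⁻ y, g y ∂signedMeasure ρ = 2⁻¹ * (∫⁻ x, g (1, x) ∂ρ + ∫⁻ x, g (-1, x) ∂ρ) := by
  rw [signedMeasure, lintegral_smul_measure, lintegral_add_measure, lintegral_map hg (by fun_prop),
    lintegral_map hg (by fun_prop), smul_eq_mul]

instance {E : Type*} [MeasurableSpace E] (ρ : Measure E) [IsProbabilityMeasure ρ] :
    IsProbabilityMeasure (signedMeasure ρ) := ⟨by
  rw [← lintegral_one, lintegral_signedMeasure ρ measurable_const]
  simp only [lintegral_one, measure_univ]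
  rw [one_add_one_eq_two, ENNReal.inv_mul_cancel (by simp) (by simp)]⟩

lemma lintegral_pi_succ_iSup {J G : Type*} [MeasurableSpace G] (r : Measure G)
    [IsProbabilityMeasure r] (c : J → G → ℝ) (h : J → ℝ) (m : ℕ) :
    ∫⁻ x : Fin (m + 1) → G,
        ⨆ j, ENNReal.ofReal (Real.exp (h j + ∑ k, c j (x k))) ∂Measure.pi (fun _ => r) =
      ∫⁻ p : G × (Fin m → G), ⨆ j, ENNReal.ofReal
        (Real.exp (h j + (c j p.1 + ∑ k, c j (p.2 k)))) ∂r.prod (Measure.pi fun _ => r) := by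
  have hmp := (measurePreserving_piFinSuccAbove (fun _ : Fin (m + 1) => r) 0).symm
  rw [← hmp.lintegral_comp_emb (MeasurableEquiv.measurableEmbedding _)]
  simp [MeasurableEquiv.piFinSuccAbove_symm_apply, Fin.sum_univ_succ]

/-- Comparison of exponential moments of suprema tensorizes. -/
lemma lintegral_pi_iSup_exp_le {J E E' : Type*} [Countable J] [MeasurableSpace E]
    [MeasurableSpace E'] (ρ : Measure E) (ρ' : Measure E') [IsProbabilityMeasure ρ]
    [IsProbabilityMeasure ρ'] (a : J → E → ℝ) (b : J → E' → ℝ) (ha : ∀ j, Measurable (a j))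
    (hb : ∀ j, Measurable (b j))
    (hab : ∀ h : J → ℝ, ∫⁻ x, ⨆ j, ENNReal.ofReal (Real.exp (h j + a j x)) ∂ρ ≤
      ∫⁻ y, ⨆ j, ENNReal.ofReal (Real.exp (h j + b j y)) ∂ρ') (m : ℕ) (h : J → ℝ) :
    ∫⁻ x : Fin m → E, ⨆ j, ENNReal.ofReal (Real.exp (h j + ∑ k, a j (x k)))
        ∂Measure.pi (fun _ => ρ) ≤
      ∫⁻ y : Fin m → E', ⨆ j, ENNReal.ofReal (Real.exp (h j + ∑ k, b j (y k)))
        ∂Measure.pi (fun _ => ρ') := by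
  induction m generalizing h with
  | zero => simp
  | succ m ih =>
    rw [lintegral_pi_succ_iSup, lintegral_pi_succ_iSup]
    have hm1 : Measurable fun p : E × (Fin m → E) => ⨆ j, ENNReal.ofReal
        (Real.exp (h j + (a j p.1 + ∑ k, a j (p.2 k)))) :=
      .iSup fun j => by have := ha j; fun_prop
    have hm2 : Measurable fun p : E × (Fin m → E') => ⨆ j, ENNReal.ofReal
        (Real.exp (h j + (a j p.1 + ∑ k, b j (p.2 k)))) :=
      .iSup fun j => by have := ha j; have := hb j; fun_prop
    have hm3 : Measurable fun p : E' × (Fin m → E') => ⨆ j, ENNReal.ofReal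
        (Real.exp (h j + (b j p.1 + ∑ k, b j (p.2 k)))) :=
      .iSup fun j => by have := hb j; fun_prop
    rw [lintegral_prod _ hm1.aemeasurable, lintegral_prod_symm _ hm3.aemeasurable]
    -- With the first coordinate frozen inside `h`, induction replaces the others; after swapping
    -- the integrals, `hab` replaces the first one. This is why `h` must be arbitrary.
    calc _ ≤ ∫⁻ x, ∫⁻ y : Fin m → E', ⨆ j, ENNReal.ofReal
          (Real.exp (h j + (a j x + ∑ k, b j (y k)))) ∂Measure.pi (fun _ => ρ') ∂ρ := by
          refine lintegral_mono fun x => ?_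
          simpa only [add_assoc] using ih (fun j => h j + a j x)
      _ = ∫⁻ y : Fin m → E', ∫⁻ x, ⨆ j, ENNReal.ofReal
          (Real.exp (h j + (a j x + ∑ k, b j (y k)))) ∂ρ ∂Measure.pi (fun _ => ρ') :=
          lintegral_lintegral_swap hm2.aemeasurable
      _ ≤ _ := by
          refine lintegral_mono fun y => ?_
          have := hab (fun j => h j + ∑ k, b j (y k))
          simpa only [add_assoc, add_comm, add_left_comm] using this

/-- Symmetrization and contraction for the lower deviations of `∑ |f j (x k)|`. -/
lemma lintegral_pi_symmetrization {J E : Type*} [Countable J] [MeasurableSpace E] (ρ : Measure E)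
    [IsProbabilityMeasure ρ] (f : J → E → ℝ) (hm : ∀ j, Measurable (f j))
    (hf : ∀ j, Integrable (f j) ρ) (l : ℝ) (hl : 0 ≤ l) (m : ℕ) :
    ∫⁻ x : Fin m → E, ⨆ j, ENNReal.ofReal
        (Real.exp (∑ k, l * (∫ y, |f j y| ∂ρ - |f j (x k)|))) ∂Measure.pi (fun _ => ρ) ≤
      ∫⁻ y : Fin m → ℝ × E, ⨆ j, ENNReal.ofReal
        (Real.exp (∑ k, 2 * l * ((y k).1 * f j (y k).2))) ∂Measure.pi (fun _ => signedMeasure ρ) := by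
  have hb : ∀ j, Measurable fun y : ℝ × E => 2 * l * (y.1 * f j y.2) := fun j => by
    have := hm j; fun_prop
  have := lintegral_pi_iSup_exp_le ρ (signedMeasure ρ)
    (fun j x => l * (∫ y, |f j y| ∂ρ - |f j x|)) (fun j y => 2 * l * (y.1 * f j y.2))
    (fun j => by have := hm j; fun_prop) hb (fun h => ?_) m 0
  · simpa using this
  · refine (lintegral_iSup_exp_le ρ f hm hf l hl h).trans (le_of_eq ?_)
    rw [lintegral_signedMeasure ρ (.iSup fun j => by have := hb j; fun_prop)]
    simp [sub_eq_add_neg]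

/-! ### Exponential moments and Chernoff bounds -/

lemma lintegral_pi_prod {E : Type*} [MeasurableSpace E] (ρ : Measure E)
    [IsProbabilityMeasure ρ] {g : E → ENNReal} (hg : Measurable g) (m : ℕ) :
    ∫⁻ x : Fin m → E, ∏ k, g (x k) ∂Measure.pi (fun _ => ρ) = (∫⁻ x, g x ∂ρ) ^ m := by
  induction m with
  | zero => simp
  | succ m ih =>
    have hmp := (measurePreserving_piFinSuccAbove (fun _ : Fin (m + 1) => ρ) 0).symm
    rw [← hmp.lintegral_comp_emb (MeasurableEquiv.measurableEmbedding _)]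
    simp only [MeasurableEquiv.piFinSuccAbove_symm_apply, Fin.insertNthEquiv_zero,
      Fin.consEquiv_apply, Fin.prod_univ_succ, Fin.cons_zero, Fin.cons_succ]
    have hP : Measurable fun x : Fin m → E => ∏ k, g (x k) := by fun_prop
    rw [pow_succ', ← ih]
    exact lintegral_prod_mul hg.aemeasurable hP.aemeasurable

/-- Exponential moments of a nonnegative variable with moments `𝔼 T ^ N ≤ C N!`. -/
lemma lintegral_exp_le_of_moments {E : Type*} [MeasurableSpace E] (ρ : Measure E)
    [IsProbabilityMeasure ρ] {T : E → ℝ} (hT : Measurable T) (hT0 : ∀ x, 0 ≤ T x) {C μ : ℝ}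
    (hC : 0 ≤ C) (hmom : ∀ N : ℕ, 1 ≤ N → Integrable (fun x => T x ^ N) ρ ∧
      ∫ x, T x ^ N ∂ρ ≤ C * (N ! : ℝ)) (hμ : ∫ x, T x ∂ρ = μ) {s : ℝ} (hs : |s| ≤ 1 / 2) :
    ∫⁻ x, ENNReal.ofReal (Real.exp (s * T x)) ∂ρ ≤
      ENNReal.ofReal (Real.exp (s * μ + 2 * C * s ^ 2)) := by
  set G : E → ℝ := fun x => Real.exp (|s| * T x) - 1 - |s| * T x with hG
  have hGm : Measurable G := by fun_prop
  have hsum : ∀ x, HasSum (fun N : ℕ => (|s| * T x) ^ (N + 2) / ((N + 2)! : ℝ)) (G x) := by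
    intro x
    have h := NormedSpace.expSeries_div_hasSum_exp (𝔸 := ℝ) (|s| * T x)
    rw [← Real.exp_eq_exp_ℝ] at h
    have := (hasSum_nat_add_iff' 2).2 h
    simpa [Finset.sum_range_succ, hG, sub_sub] using this
  have hG0 : ∀ x, 0 ≤ G x := fun x => (hsum x).nonneg fun N => by
    have := hT0 x
    positivity
  have hTint : Integrable T ρ := by simpa using (hmom 1 le_rfl).1
  have hGl : ∫⁻ x, ENNReal.ofReal (G x) ∂ρ ≤ ENNReal.ofReal (2 * C * s ^ 2) := by
    have h1 : ∀ x, ENNReal.ofReal (G x) =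
        ∑' N : ℕ, ENNReal.ofReal ((|s| * T x) ^ (N + 2) / ((N + 2)! : ℝ)) := by
      intro x
      rw [← (hsum x).tsum_eq, ENNReal.ofReal_tsum_of_nonneg (fun N => ?_) (hsum x).summable]
      have := hT0 x
      positivity
    simp_rw [h1]
    rw [lintegral_tsum (fun N => by fun_prop)]
    -- The factorial in the moment bound cancels that of the exponential series, leaving a geometric
    -- series of ratio at most `1/2`.
    have h2 : ∀ N : ℕ, ∫⁻ x, ENNReal.ofReal ((|s| * T x) ^ (N + 2) / ((N + 2)! : ℝ)) ∂ρ ≤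
        ENNReal.ofReal (C * |s| ^ 2 * (1 / 2) ^ N) := by
      intro N
      obtain ⟨hi, hb⟩ := hmom (N + 2) (by omega)
      have e : ∀ x, (|s| * T x) ^ (N + 2) / ((N + 2)! : ℝ) =
          |s| ^ (N + 2) / ((N + 2)! : ℝ) * T x ^ (N + 2) := fun x => by rw [mul_pow]; ring
      simp_rw [e]
      rw [← ofReal_integral_eq_lintegral_ofReal (hi.const_mul _)
        (Filter.Eventually.of_forall fun x => by have := hT0 x; positivity)]
      refine ENNReal.ofReal_le_ofReal ?_
      rw [integral_const_mul]
      calc |s| ^ (N + 2) / ((N + 2)! : ℝ) * ∫ x, T x ^ (N + 2) ∂ρ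
          ≤ |s| ^ (N + 2) / ((N + 2)! : ℝ) * (C * ((N + 2)! : ℝ)) := by gcongr
        _ = C * |s| ^ 2 * |s| ^ N := by
          have : ((N + 2)! : ℝ) ≠ 0 := by positivity
          field_simp
          ring
        _ ≤ _ := by gcongr
    refine (ENNReal.tsum_le_tsum h2).trans (le_of_eq ?_)
    have hs2 : HasSum (fun N : ℕ => C * |s| ^ 2 * (1 / 2 : ℝ) ^ N) (C * |s| ^ 2 * 2) :=
      hasSum_geometric_two.mul_left _
    rw [← ENNReal.ofReal_tsum_of_nonneg (fun N => by positivity) hs2.summable, hs2.tsum_eq, sq_abs]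
    congr 1
    ring
  have hGint : Integrable G ρ := by
    refine ⟨hGm.aestronglyMeasurable, ?_⟩
    rw [hasFiniteIntegral_iff_ofReal (Filter.Eventually.of_forall hG0)]
    exact hGl.trans_lt ENNReal.ofReal_lt_top
  have hGI : ∫ x, G x ∂ρ ≤ 2 * C * s ^ 2 := by
    rw [← ENNReal.ofReal_le_ofReal_iff (by positivity),
      ofReal_integral_eq_lintegral_ofReal hGint (Filter.Eventually.of_forall hG0)]
    exact hGl
  have hpt : ∀ x, Real.exp (s * T x) ≤ 1 + s * T x + G x := by
    intro x
    rcases le_total 0 s with h | h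
    · simp [hG, abs_of_nonneg h]
    · simp only [hG, abs_of_nonpos h]
      have hu : 0 ≤ -s * T x := mul_nonneg (by linarith) (hT0 x)
      -- For negative `s`, put `u = -s * T x`: the claim is `exp (-u) ≤ exp u - 2 u`, that is `u ≤
      -- sinh u`.
      have := Real.self_le_sinh_iff.2 hu
      rw [Real.sinh_eq] at this
      have e : -(-s * T x) = s * T x := by ring
      rw [e] at this
      linarith
  have hint : Integrable (fun x => 1 + s * T x + G x) ρ :=
    ((integrable_const _).add (hTint.const_mul _)).add hGint
  calc ∫⁻ x, ENNReal.ofReal (Real.exp (s * T x)) ∂ρ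
      ≤ ∫⁻ x, ENNReal.ofReal (1 + s * T x + G x) ∂ρ :=
        lintegral_mono fun x => ENNReal.ofReal_le_ofReal (hpt x)
    _ = ENNReal.ofReal (∫ x, (1 + s * T x + G x) ∂ρ) :=
        (ofReal_integral_eq_lintegral_ofReal hint (Filter.Eventually.of_forall fun x =>
          (Real.exp_pos _).le.trans (hpt x))).symm
    _ ≤ _ := by
        refine ENNReal.ofReal_le_ofReal ?_
        have h1T : Integrable (fun x => 1 + s * T x) ρ :=
          (integrable_const _).add (hTint.const_mul _)
        rw [integral_add h1T hGint,
          integral_add (integrable_const _) (hTint.const_mul _), integral_const_mul, hμ]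
        simp only [integral_const, probReal_univ, one_smul]
        have := Real.add_one_le_exp (s * μ + 2 * C * s ^ 2)
        linarith

lemma norm_inner_pow_eq {n : ℕ} (α x : EuclideanSpace ℂ (Fin n)) (N : ℕ) :
    ‖(inner ℂ α x : ℂ)‖ ^ (2 * N) = quadForm x (ketbra α) ^ N := by
  rw [quadForm_ketbra, pow_mul]

lemma quadForm_ketbra_comm {n : ℕ} (a x : EuclideanSpace ℂ (Fin n)) :
    quadForm x (ketbra a) = quadForm a (ketbra x) := by
  rw [quadForm_ketbra, quadForm_ketbra, norm_inner_symm]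

lemma measurable_quadForm_ketbra {n : ℕ} (x : EuclideanSpace ℂ (Fin n)) :
    Measurable fun α : EuclideanSpace ℂ (Fin n) => quadForm x (ketbra α) := by
  simp_rw [quadForm_ketbra_comm _ x]
  exact (continuous_quadForm_left _).measurable

lemma lintegral_exp_quadForm_le {n : ℕ} {ρ : Measure (EuclideanSpace ℂ (Fin n))}
    [IsProbabilityMeasure ρ] {CI CSG : ℝ} (hCSG : 0 ≤ CSG) (hI : Isotropic ρ CI)
    (hSG : SubGaussianMoments ρ CSG) {x : EuclideanSpace ℂ (Fin n)} (hx : ‖x‖ = 1) {s : ℝ}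
    (hs : |s| ≤ 1 / 2) :
    ∫⁻ α, ENNReal.ofReal (Real.exp (s * quadForm x (ketbra α))) ∂ρ ≤
      ENNReal.ofReal (Real.exp (s * CI + 2 * CSG * s ^ 2)) := by
  refine lintegral_exp_le_of_moments ρ (measurable_quadForm_ketbra x)
    (fun α => by rw [quadForm_ketbra]; positivity) hCSG (fun N hN => ?_) ?_ hs
  · simpa only [norm_inner_pow_eq] using hSG x hx N hN
  · simpa only [quadForm_ketbra, hx, one_pow, mul_one] using hI x

lemma lintegral_pi_exp_sum_le {E : Type*} [MeasurableSpace E] (ρ : Measure E)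
    [IsProbabilityMeasure ρ] {g : E → ℝ} (hg : Measurable g) {c : ℝ}
    (h : ∫⁻ x, ENNReal.ofReal (Real.exp (g x)) ∂ρ ≤ ENNReal.ofReal (Real.exp c)) (m : ℕ) :
    ∫⁻ x : Fin m → E, ENNReal.ofReal (Real.exp (∑ k, g (x k))) ∂Measure.pi (fun _ => ρ) ≤
      ENNReal.ofReal (Real.exp (m * c)) := by
  have e : ∀ x : Fin m → E, ENNReal.ofReal (Real.exp (∑ k, g (x k))) =
      ∏ k, ENNReal.ofReal (Real.exp (g (x k))) := fun x => by
    rw [Real.exp_sum, ENNReal.ofReal_prod_of_nonneg fun _ _ => (Real.exp_pos _).le]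
  simp_rw [e]
  rw [lintegral_pi_prod ρ (by fun_prop : Measurable fun x => ENNReal.ofReal (Real.exp (g x))),
    Real.exp_nat_mul, ENNReal.ofReal_pow (Real.exp_pos _).le]
  gcongr

/-- Exponential Markov inequality for the outer measure: `S` need not be measurable, so the
exceptional events may be treated directly. -/
lemma measure_le_of_lintegral_exp {E : Type*} [MeasurableSpace E] (μ : Measure E)
    {F : E → ENNReal} (hF : Measurable F) {c t : ℝ} {S : Set E}
    (hS : ∀ x ∈ S, ENNReal.ofReal (Real.exp t) ≤ F x)
    (h : ∫⁻ x, F x ∂μ ≤ ENNReal.ofReal c) :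
    μ S ≤ ENNReal.ofReal (c * Real.exp (-t)) := by
  have h1 := (mul_meas_ge_le_lintegral hF (μ := μ) (ENNReal.ofReal (Real.exp t))).trans h
  have h2 : μ S ≤ μ {x | ENNReal.ofReal (Real.exp t) ≤ F x} := measure_mono hS
  refine h2.trans ?_
  rw [Real.exp_neg, ← div_eq_mul_inv, ENNReal.ofReal_div_of_pos (Real.exp_pos _)]
  rw [ENNReal.le_div_iff_mul_le (by simp [Real.exp_pos]) (by simp), mul_comm]
  exact h1

/-! ### Frame operator near the identity -/

/-- The random frame operator is close to the identity with high probability. -/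
lemma measure_not_frameNearIdentity_le {n m : ℕ} (hm : 0 < m)
    {ρ : Measure (EuclideanSpace ℂ (Fin n))}
    [IsProbabilityMeasure ρ] {CI CSG : ℝ} (hCI : 0 < CI) (hCSG : 0 ≤ CSG) (hI : Isotropic ρ CI)
    (hSG : SubGaussianMoments ρ CSG) {s : ℝ} (hs0 : 0 ≤ s) (hs : s ≤ 1 / 2) :
    Measure.pi (fun _ : Fin m => ρ) {x | ¬ FrameNearIdentity CI (fun k => ketbra (x k))} ≤
      ENNReal.ofReal (2 * 25 ^ n * Real.exp (m * (2 * CSG * s ^ 2 - s * (CI / 204)))) := by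
  obtain ⟨N, hcard, hN1, hnet⟩ := exists_half_net n
  have hm' : (0 : ℝ) < m := Nat.cast_pos.2 hm
  let S : EuclideanSpace ℂ (Fin n) × ℝ → Set (Fin m → EuclideanSpace ℂ (Fin n)) := fun p =>
    {x | s * (m * (CI / 204)) ≤ ∑ k, p.2 * s * (quadForm p.1 (ketbra (x k)) - CI)}
  have hsub : {x : Fin m → EuclideanSpace ℂ (Fin n) |
      ¬ FrameNearIdentity CI (fun k => ketbra (x k))} ⊆ ⋃ p ∈ N ×ˢ {1, -1}, S p := by
    intro x hx
    by_contra hcon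
    refine hx ?_
    rw [FrameNearIdentity]
    have hH : (((1 / (CI * m) : ℝ) : ℂ) • ∑ k, ketbra (x k) - 1 :
        Matrix (Fin n) (Fin n) ℂ).IsHermitian := by
      refine Matrix.IsHermitian.sub ?_ Matrix.isHermitian_one
      rw [Matrix.IsHermitian, Matrix.conjTranspose_smul, Matrix.conjTranspose_sum]
      simp [(isHermitian_ketbra _).eq]
    -- `204 = 34 * 6`: the net loses a factor 34 and the target is `1/6`.
    have := opNorm_le_of_net hH hN1 hnet (b := 1 / 204) (by norm_num) (fun y hy => ?_)
    · linarith
    · simp only [Set.mem_iUnion, not_exists] at hcon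
      have h1 := hcon (y, 1) (by simp [hy])
      have h2 := hcon (y, -1) (by simp [hy])
      simp only [S, Set.mem_ofPred_eq, not_le, ← Finset.mul_sum, Finset.sum_sub_distrib,
        Finset.sum_const, Finset.card_univ, Fintype.card_fin, nsmul_eq_mul] at h1 h2
      have hs' : 0 < s := by
        rcases hs0.eq_or_lt with h | h
        · simp [← h] at h1
        · exact h
      have e : quadForm y (((1 / (CI * m) : ℝ) : ℂ) • ∑ k, ketbra (x k) - 1) =
          (∑ k, quadForm y (ketbra (x k)) - m * CI) / (CI * m) := by
        rw [Complex.coe_smul, map_sub, map_smul, map_sum, quadForm_one, hN1 y hy, smul_eq_mul]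
        field_simp
      rw [e, abs_div, abs_of_pos (by positivity : 0 < CI * m), div_le_iff₀ (by positivity), abs_le]
      constructor
      · have h3 := lt_of_mul_lt_mul_left (b := -(∑ k, quadForm y (ketbra (x k)) - m * CI))
          (c := m * (CI / 204)) (a := s) (by linarith) hs0
        linarith
      · have h3 := lt_of_mul_lt_mul_left (b := (∑ k, quadForm y (ketbra (x k)) - m * CI))
          (c := m * (CI / 204)) (a := s) (by linarith) hs0
        linarith
  have hS : ∀ p ∈ N ×ˢ ({1, -1} : Finset ℝ), Measure.pi (fun _ : Fin m => ρ) (S p) ≤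
      ENNReal.ofReal (Real.exp (m * (2 * CSG * s ^ 2 - s * (CI / 204)))) := by
    rintro ⟨y, σ⟩ hp
    obtain ⟨hy, hσ⟩ := Finset.mem_product.1 hp
    have hσ2 : |σ| = 1 := by
      simp only [Finset.mem_insert, Finset.mem_singleton] at hσ
      rcases hσ with rfl | rfl <;> simp
    have hT := measurable_quadForm_ketbra y
    have hg : Measurable fun α : EuclideanSpace ℂ (Fin n) =>
        σ * s * (quadForm y (ketbra α) - CI) := by fun_prop
    have h1 : ∫⁻ α, ENNReal.ofReal (Real.exp (σ * s * (quadForm y (ketbra α) - CI))) ∂ρ ≤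
        ENNReal.ofReal (Real.exp (2 * CSG * s ^ 2)) := by
      have h2 := lintegral_exp_quadForm_le hCSG hI hSG (hN1 y hy) (s := σ * s)
        (by rw [abs_mul, hσ2, one_mul, abs_of_nonneg hs0]; exact hs)
      have e : ∀ α : EuclideanSpace ℂ (Fin n),
          ENNReal.ofReal (Real.exp (σ * s * (quadForm y (ketbra α) - CI))) =
          ENNReal.ofReal (Real.exp (-(σ * s * CI))) *
            ENNReal.ofReal (Real.exp (σ * s * quadForm y (ketbra α))) := fun α => by
        rw [← ENNReal.ofReal_mul (Real.exp_pos _).le, ← Real.exp_add]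
        ring_nf
      simp_rw [e]
      rw [lintegral_const_mul _ (by fun_prop)]
      refine (mul_le_mul_right h2 _).trans (le_of_eq ?_)
      rw [← ENNReal.ofReal_mul (Real.exp_pos _).le, ← Real.exp_add, mul_pow, ← sq_abs σ, hσ2]
      ring_nf
    have h3 := measure_le_of_lintegral_exp (Measure.pi (fun _ : Fin m => ρ))
      (F := fun x => ENNReal.ofReal (Real.exp (∑ k, σ * s * (quadForm y (ketbra (x k)) - CI))))
      (Real.measurable_exp.comp (Finset.measurable_sum _ fun k _ =>
        hg.comp (measurable_pi_apply k))).ennreal_ofReal (S := S (y, σ)) (fun x hx => ENNReal.ofReal_le_ofReal (Real.exp_le_exp.2 hx))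
      (lintegral_pi_exp_sum_le ρ hg h1 m)
    refine h3.trans (le_of_eq ?_)
    rw [← Real.exp_add]
    ring_nf
  calc _ ≤ _ := measure_mono hsub
    _ ≤ ∑ p ∈ N ×ˢ ({1, -1} : Finset ℝ), Measure.pi (fun _ : Fin m => ρ) (S p) :=
        measure_biUnion_finset_le _ _
    _ ≤ _ := Finset.sum_le_card_nsmul _ _ _ hS
    _ ≤ _ := by
        rw [Finset.card_product, Finset.card_pair (by norm_num), nsmul_eq_mul,
          ← ENNReal.ofReal_natCast, ← ENNReal.ofReal_mul (by positivity)]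
        refine ENNReal.ofReal_le_ofReal ?_
        gcongr
        push_cast
        have : (N.card : ℝ) ≤ 25 ^ n := by exact_mod_cast hcard
        linarith

/-! ### Lower bound for the first absolute moment on `D` -/

/-- As `t ↦ t ^ 4` is convex, the condition defines a convex set, so only the extreme generators `±
|x⟩⟨x|` matter. There it is the tail hypothesis with `N = 4`, and `24 = 4!`. -/
lemma fourth_moment_of_mem_traceBall {n : ℕ} {ρ : Measure (EuclideanSpace ℂ (Fin n))}
    {CSG : ℝ} (hSG : SubGaussianMoments ρ CSG) {W : Matrix (Fin n) (Fin n) ℂ}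
    (hW : W ∈ traceBall n) :
    Integrable (fun α => quadForm α W ^ 4) ρ ∧ ∫ α, quadForm α W ^ 4 ∂ρ ≤ 24 * CSG := by
  have hpow : ConvexOn ℝ Set.univ fun t : ℝ => t ^ 4 := Even.convexOn_pow (by decide)
  have hconv : Convex ℝ {W : Matrix (Fin n) (Fin n) ℂ |
      Integrable (fun α => quadForm α W ^ 4) ρ ∧ ∫ α, quadForm α W ^ 4 ∂ρ ≤ 24 * CSG} := by
    rintro V ⟨hV, hV'⟩ W ⟨hW, hW'⟩ a b ha hb hab
    have hle : ∀ α : EuclideanSpace ℂ (Fin n), quadForm α (a • V + b • W) ^ 4 ≤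
        a * quadForm α V ^ 4 + b * quadForm α W ^ 4 := fun α => by
      rw [map_add, map_smul, map_smul]
      exact hpow.2 (Set.mem_univ _) (Set.mem_univ _) ha hb hab
    have hint := (hV.const_mul a).add (hW.const_mul b)
    have hi : Integrable (fun α => quadForm α (a • V + b • W) ^ 4) ρ := by
      refine hint.mono' ((continuous_quadForm_left _).pow 4).aestronglyMeasurable
        (Filter.Eventually.of_forall fun α => ?_)
      rw [Real.norm_of_nonneg (by positivity)]
      exact hle α
    refine ⟨hi, (integral_mono hi hint hle).trans ?_⟩
    simp only [Pi.add_apply]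
    rw [integral_add (hV.const_mul a) (hW.const_mul b), integral_const_mul, integral_const_mul]
    calc _ ≤ a * (24 * CSG) + b * (24 * CSG) := by gcongr
      _ = _ := by rw [← add_mul, hab, one_mul]
  refine convexHull_min ?_ hconv hW
  rintro _ ⟨x, hx, h⟩
  have hx4 := hSG x hx 4 (by norm_num)
  have e : ∀ Z, (Z = ketbra x ∨ Z = -ketbra x) → ∀ α : EuclideanSpace ℂ (Fin n),
      quadForm α Z ^ 4 = ‖(inner ℂ α x : ℂ)‖ ^ (2 * 4) := by
    rintro _ (rfl | rfl) α
    · rw [norm_inner_pow_eq, quadForm_ketbra_comm]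
    · rw [norm_inner_pow_eq, map_neg, quadForm_ketbra_comm, Even.neg_pow (by decide)]
  simp only [Set.mem_ofPred_eq, e _ h]
  refine ⟨hx4.1, hx4.2.trans (le_of_eq ?_)⟩
  norm_num [Nat.factorial]
  ring

lemma integrable_quadForm_of_mem_testSet {n : ℕ} {ρ : Measure (EuclideanSpace ℂ (Fin n))}
    [IsProbabilityMeasure ρ] {CSG : ℝ} (hSG : SubGaussianMoments ρ CSG)
    {Z : Matrix (Fin n) (Fin n) ℂ} (hZ : Z ∈ testSet n) :
    Integrable (fun α => quadForm α Z ^ 4) ρ ∧ ∫ α, quadForm α Z ^ 4 ∂ρ ≤ 1944 * CSG ∧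
      Integrable (fun α => quadForm α Z) ρ := by
  obtain ⟨W, hW, rfl⟩ := hZ.2
  obtain ⟨h1, h2⟩ := fourth_moment_of_mem_traceBall hSG hW
  have e : ∀ α : EuclideanSpace ℂ (Fin n), quadForm α ((3 : ℝ) • W) ^ 4 = 81 * quadForm α W ^ 4 :=
    fun α => by rw [map_smul, smul_eq_mul, mul_pow]; norm_num
  have h4 : Integrable (fun α => quadForm α ((3 : ℝ) • W) ^ 4) ρ := by
    simp_rw [e]
    exact h1.const_mul _
  refine ⟨h4, ?_, ?_⟩
  · simp_rw [e]
    rw [integral_const_mul]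
    linarith
  · refine ((integrable_const (1 : ℝ)).add h4).mono'
      (continuous_quadForm_left _).aestronglyMeasurable (Filter.Eventually.of_forall fun α => ?_)
    simp only [Real.norm_eq_abs, Pi.add_apply]
    generalize quadForm α ((3 : ℝ) • W) = t
    rw [abs_le]
    constructor <;> nlinarith [sq_nonneg (t ^ 2 - 1), sq_nonneg (t - 1), sq_nonneg (t + 1)]

/-- A lower bound for `𝔼 |⟨α|Z|α⟩|`, by comparing second and fourth moments. -/
lemma le_integral_abs_quadForm {n : ℕ} {ρ : Measure (EuclideanSpace ℂ (Fin n))}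
    [IsProbabilityMeasure ρ] {CSI CSG : ℝ} (hCSI : 0 < CSI) (hCSG : 0 < CSG)
    (hSI : SubIsotropic ρ CSI) (hSG : SubGaussianMoments ρ CSG)
    {Z : Matrix (Fin n) (Fin n) ℂ} (hZ : Z ∈ testSet n) :
    CSI / (2 * √(3888 * CSG / CSI)) ≤ ∫ α, |quadForm α Z| ∂ρ := by
  obtain ⟨h4, h4', h1⟩ := integrable_quadForm_of_mem_testSet hSG hZ
  -- Truncation level: `3888 = 2 * 1944`, so the part with `|t| ≥ β` accounts for at most half of
  -- the second moment.
  set β := √(3888 * CSG / CSI) with hβ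
  have hβ0 : 0 < β := by positivity
  have hβ2 : β ^ 2 = 3888 * CSG / CSI := Real.sq_sqrt (by positivity)
  have hpt : ∀ α : EuclideanSpace ℂ (Fin n),
      quadForm α Z ^ 2 ≤ β * |quadForm α Z| + 1 / β ^ 2 * quadForm α Z ^ 4 := by
    intro α
    generalize quadForm α Z = t
    rcases le_total |t| β with h | h
    · have : 0 ≤ 1 / β ^ 2 * t ^ 4 := by positivity
      nlinarith [sq_abs t, abs_nonneg t]
    · have h2 : β ^ 2 ≤ t ^ 2 := by rw [← sq_abs t]; gcongr
      have : t ^ 2 ≤ 1 / β ^ 2 * t ^ 4 := by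
        rw [one_div_mul_eq_div, le_div_iff₀ (by positivity)]
        nlinarith [sq_nonneg t]
      have := mul_nonneg hβ0.le (abs_nonneg t)
      linarith
  have hint := (h1.abs.const_mul β).add (h4.const_mul (1 / β ^ 2))
  have hsq : Integrable (fun α => quadForm α Z ^ 2) ρ := by
    refine hint.mono' ((continuous_quadForm_left _).pow 2).aestronglyMeasurable
      (Filter.Eventually.of_forall fun α => ?_)
    rw [Real.norm_of_nonneg (by positivity)]
    exact hpt α
  have hlow : CSI ≤ ∫ α, quadForm α Z ^ 2 ∂ρ := by
    have := hSI Z hZ.1.1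
    rw [hZ.1.2, one_pow, mul_one] at this
    exact this
  have hup := integral_mono hsq hint hpt
  simp only [Pi.add_apply] at hup
  rw [integral_add (h1.abs.const_mul β) (h4.const_mul _), integral_const_mul,
    integral_const_mul, hβ2] at hup
  have h5 : 1 / (3888 * CSG / CSI) * ∫ α, quadForm α Z ^ 4 ∂ρ ≤ CSI / 2 := by
    calc _ ≤ 1 / (3888 * CSG / CSI) * (1944 * CSG) := by gcongr
      _ = _ := by field_simp; norm_num
  rw [div_le_iff₀ (by positivity)]
  linarith

/-! ### Uniform lower bound on `D` -/

/-- Exponential moments of the supremum over `D` of the symmetrized process. -/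
lemma lintegral_signed_iSup_le {n m : ℕ} (hn : 0 < n) {ρ : Measure (EuclideanSpace ℂ (Fin n))}
    [IsProbabilityMeasure ρ] {CI CSG : ℝ} (hCSG : 0 ≤ CSG) (hI : Isotropic ρ CI)
    (hSG : SubGaussianMoments ρ CSG) {J : Type*} (Z : J → Matrix (Fin n) (Fin n) ℂ)
    (hZ : ∀ j, Z j ∈ testSet n) {l : ℝ} (hl0 : 0 ≤ l) (hl : 204 * l ≤ 1 / 2) :
    ∫⁻ y : Fin m → ℝ × EuclideanSpace ℂ (Fin n), ⨆ j, ENNReal.ofReal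
        (Real.exp (∑ k, 2 * l * ((y k).1 * quadForm (y k).2 (Z j))))
          ∂Measure.pi (fun _ => signedMeasure ρ) ≤
      ENNReal.ofReal (2 * 25 ^ n *
        Real.exp (m * ((CI ^ 2 / 2 + 2 * CSG) * (204 * l) ^ 2))) := by
  obtain ⟨N, hcard, hN1, hnet⟩ := exists_half_net n
  have hNne : N.Nonempty := by
    obtain ⟨y, hy, -⟩ := hnet (EuclideanSpace.single ⟨0, hn⟩ 1) (by simp)
    exact ⟨y, hy⟩
  set K := CI ^ 2 / 2 + 2 * CSG
  let g : EuclideanSpace ℂ (Fin n) × ℝ → ℝ × EuclideanSpace ℂ (Fin n) → ℝ := fun p y =>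
    p.2 * (204 * l) * (y.1 * quadForm p.1 (ketbra y.2))
  have hgm : ∀ p, Measurable (g p) := fun p =>
    (measurable_fst.mul ((measurable_quadForm_ketbra p.1).comp measurable_snd)).const_mul _
  have hg : ∀ p ∈ N ×ˢ ({1, -1} : Finset ℝ),
      ∫⁻ y, ENNReal.ofReal (Real.exp (g p y)) ∂signedMeasure ρ ≤
        ENNReal.ofReal (Real.exp (K * (204 * l) ^ 2)) := by
    rintro ⟨y, σ⟩ hp
    obtain ⟨hy, hσ⟩ := Finset.mem_product.1 hp
    have hσ2 : |σ| = 1 := by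
      simp only [Finset.mem_insert, Finset.mem_singleton] at hσ
      rcases hσ with rfl | rfl <;> simp
    have hmg := hgm (y, σ)
    rw [lintegral_signedMeasure ρ (by fun_prop)]
    set c := σ * (204 * l) with hc
    have hc2 : c ^ 2 = (204 * l) ^ 2 := by rw [hc, mul_pow, ← sq_abs σ, hσ2]; ring
    have habs : |c| ≤ 1 / 2 := by
      rw [hc, abs_mul, hσ2, one_mul, abs_of_nonneg (by positivity)]; exact hl
    have h1 := lintegral_exp_quadForm_le hCSG hI hSG (hN1 y hy) habs
    have h2 := lintegral_exp_quadForm_le hCSG hI hSG (hN1 y hy) (s := -c) (by rwa [abs_neg])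
    have e1 : ∀ α, g (y, σ) (1, α) = c * quadForm y (ketbra α) := fun α => by simp [g, hc]
    have e2 : ∀ α, g (y, σ) (-1, α) = -c * quadForm y (ketbra α) := fun α => by simp [g, hc]
    simp_rw [e1, e2]
    refine (mul_le_mul_right (add_le_add h1 h2) _).trans ?_
    rw [← ENNReal.ofReal_add (Real.exp_pos _).le (Real.exp_pos _).le, ← ENNReal.ofReal_ofNat 2,
      ← ENNReal.ofReal_inv_of_pos two_pos, ← ENNReal.ofReal_mul (by norm_num)]
    refine ENNReal.ofReal_le_ofReal ?_
    -- Averaging over the sign turns the mean term into `cosh (c * CI)`, so no contribution of first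
    -- order in `c` remains.
    have h3 := Real.cosh_le_exp_half_sq (c * CI)
    rw [Real.cosh_eq] at h3
    calc _ = (Real.exp (c * CI) + Real.exp (-(c * CI))) / 2 * Real.exp (2 * CSG * c ^ 2) := by
          rw [Real.exp_add, Real.exp_add, neg_sq, neg_mul]; ring
      _ ≤ Real.exp ((c * CI) ^ 2 / 2) * Real.exp (2 * CSG * c ^ 2) := by gcongr
      _ = _ := by rw [← Real.exp_add, mul_pow, hc2]; congr 1; ring
  have hpt : ∀ y : Fin m → ℝ × EuclideanSpace ℂ (Fin n),
      (⨆ j, ENNReal.ofReal (Real.exp (∑ k, 2 * l * ((y k).1 * quadForm (y k).2 (Z j))))) ≤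
        ∑ p ∈ N ×ˢ ({1, -1} : Finset ℝ), ENNReal.ofReal (Real.exp (∑ k, g p (y k))) := by
    intro y
    refine iSup_le fun j => ?_
    set M : Matrix (Fin n) (Fin n) ℂ := ∑ k, (y k).1 • ketbra (y k).2 with hM
    have hMH : M.IsHermitian := by
      rw [Matrix.IsHermitian, hM, Matrix.conjTranspose_sum]
      simp [(isHermitian_ketbra _).eq, Matrix.conjTranspose_smul]
    have hqM : ∀ u, quadForm u M = ∑ k, (y k).1 * quadForm u (ketbra (y k).2) := fun u => by
      simp [hM, map_sum, map_smul]
    obtain ⟨u, huN, hu⟩ := N.exists_max_image (fun u => |quadForm u M|) hNne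
    have hop := opNorm_le_of_net hMH hN1 hnet (abs_nonneg (quadForm u M)) hu
    let f : Matrix (Fin n) (Fin n) ℂ →ₗ[ℝ] ℝ := ∑ k, (y k).1 • quadForm (y k).2
    have hfa : ∀ W, f W = ∑ k, (y k).1 * quadForm (y k).2 W := fun W => by
      simp [f, LinearMap.sum_apply]
    -- Trace-norm duality: on rank-one matrices `f` is the quadratic form of `M`, hence at most
    -- `‖M‖_∞`. The factor 3 comes from `D` and 34 from the net; with `2 * l` this gives `204 * l`.
    have hf : |f (Z j)| ≤ 3 * (34 * |quadForm u M|) := by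
      refine abs_le_of_mem_testSet (hZ j) f fun x hx => ?_
      refine le_trans (le_of_eq ?_) ((quadForm_abs_le_opNorm M hx).trans hop)
      rw [hfa, hqM]
      simp_rw [quadForm_ketbra_comm _ x]
    have hsum : ∑ k, 2 * l * ((y k).1 * quadForm (y k).2 (Z j)) ≤ 204 * l * |quadForm u M| := by
      rw [← Finset.mul_sum, ← hfa]
      calc 2 * l * f (Z j) ≤ 2 * l * (3 * (34 * |quadForm u M|)) := by
            gcongr; exact (le_abs_self _).trans hf
        _ = _ := by ring
    obtain ⟨σ, hσ, hσu⟩ : ∃ σ ∈ ({1, -1} : Finset ℝ), |quadForm u M| = σ * quadForm u M := by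
      rcases abs_choice (quadForm u M) with h | h
      · exact ⟨1, by simp, by simp [h]⟩
      · exact ⟨-1, by simp, by simp [h]⟩
    have hle : ∑ k, 2 * l * ((y k).1 * quadForm (y k).2 (Z j)) ≤ ∑ k, g (u, σ) (y k) := by
      refine hsum.trans (le_of_eq ?_)
      simp only [g]
      rw [← Finset.mul_sum, ← hqM, hσu]
      ring
    exact (ENNReal.ofReal_le_ofReal (Real.exp_le_exp.2 hle)).trans
      (Finset.single_le_sum (f := fun p => ENNReal.ofReal (Real.exp (∑ k, g p (y k))))
        (fun _ _ => zero_le) (Finset.mem_product.2 ⟨huN, hσ⟩))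
  calc _ ≤ _ := lintegral_mono hpt
    _ = ∑ p ∈ N ×ˢ ({1, -1} : Finset ℝ), ∫⁻ y : Fin m → ℝ × EuclideanSpace ℂ (Fin n),
          ENNReal.ofReal (Real.exp (∑ k, g p (y k))) ∂Measure.pi (fun _ => signedMeasure ρ) :=
        lintegral_finsetSum _ fun p _ => by have := hgm p; fun_prop
    _ ≤ _ := Finset.sum_le_card_nsmul _ _ _ fun p hp =>
        lintegral_pi_exp_sum_le _ (hgm p) (hg p hp) m
    _ ≤ _ := by
        rw [Finset.card_product, Finset.card_pair (by norm_num), nsmul_eq_mul,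
          ← ENNReal.ofReal_natCast, ← ENNReal.ofReal_mul (by positivity)]
        refine ENNReal.ofReal_le_ofReal ?_
        gcongr
        push_cast
        have : (N.card : ℝ) ≤ 25 ^ n := by exact_mod_cast hcard
        linarith

/-- The lower bound on `D` holds with high probability. -/
lemma measure_not_l1LowerBound_le {n m : ℕ} (hn : 0 < n) (hm : 0 < m)
    {ρ : Measure (EuclideanSpace ℂ (Fin n))} [IsProbabilityMeasure ρ] {CI CSG μ₀ : ℝ}
    (hCSG : 0 ≤ CSG) (hI : Isotropic ρ CI) (hSG : SubGaussianMoments ρ CSG) (hμ₀ : 0 < μ₀)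
    (hμ : ∀ Z ∈ testSet n, μ₀ ≤ ∫ α, |quadForm α Z| ∂ρ) {l : ℝ} (hl0 : 0 < l)
    (hl : 204 * l ≤ 1 / 2) :
    Measure.pi (fun _ : Fin m => ρ) {x | ¬ L1LowerBound (2 / μ₀) (fun k => ketbra (x k))} ≤
      ENNReal.ofReal (2 * 25 ^ n *
        Real.exp (m * ((CI ^ 2 / 2 + 2 * CSG) * (204 * l) ^ 2 - l * μ₀ / 2))) := by
  have hm' : (0 : ℝ) < m := Nat.cast_pos.2 hm
  have : SecondCountableTopology (Matrix (Fin n) (Fin n) ℂ) :=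
    inferInstanceAs (SecondCountableTopology (Fin n → Fin n → ℂ))
  -- A countable dense index set keeps the supremum measurable; continuity in `Z` recovers all of
  -- `D`.
  obtain ⟨c, hc, hcd⟩ := TopologicalSpace.exists_countable_dense (testSet n)
  have : Countable c := hc.to_subtype
  let Z : c → Matrix (Fin n) (Fin n) ℂ := fun j => j.1.1
  have hZ : ∀ j, Z j ∈ testSet n := fun j => j.1.2
  have hf : ∀ j, Measurable fun α => quadForm α (Z j) := fun j =>
    (continuous_quadForm_left _).measurable
  have hint := (lintegral_pi_symmetrization ρ (fun j α => quadForm α (Z j)) hf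
    (fun j => (integrable_quadForm_of_mem_testSet hSG (hZ j)).2.2) l hl0.le m).trans
    (lintegral_signed_iSup_le hn hCSG hI hSG Z hZ hl0.le hl)
  -- Failure means some sum falls below `m * μ₀ / 2`, half the lower bound for its mean; this gives
  -- `τ = 2 / μ₀`.
  have h := measure_le_of_lintegral_exp (t := l * (m * μ₀ / 2))
    (S := {x | ¬ L1LowerBound (2 / μ₀) (fun k => ketbra (x k))}) _
    (.iSup fun j => by have := hf j; fun_prop) ?_ hint
  · refine h.trans (le_of_eq ?_)
    rw [mul_assoc, ← Real.exp_add]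
    ring_nf
  · intro x hx
    by_contra! hcon
    refine hx fun W hW => ?_
    have hdense : ∀ j, m * μ₀ / 2 ≤ ∑ k, |quadForm (x k) (Z j)| := by
      intro j
      have h1 := (le_iSup (fun j => ENNReal.ofReal (Real.exp
        (∑ k, l * (∫ y, |quadForm y (Z j)| ∂ρ - |quadForm (x k) (Z j)|)))) j).trans_lt hcon
      have h2 := Real.exp_lt_exp.1 (ENNReal.ofReal_lt_ofReal_iff (Real.exp_pos _) |>.1 h1)
      rw [← Finset.mul_sum, Finset.sum_sub_distrib, Finset.sum_const, Finset.card_univ,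
        Fintype.card_fin, nsmul_eq_mul] at h2
      have h3 := lt_of_mul_lt_mul_left h2 hl0.le
      have h4 := mul_le_mul_of_nonneg_left (hμ _ (hZ j)) hm'.le
      linarith
    have hall : m * μ₀ / 2 ≤ ∑ k, |quadForm (x k) W| := by
      have hcont : Continuous fun V : testSet n => ∑ k, |quadForm (x k) V.1| := by
        have := fun k => continuous_quadForm_right (x k)
        fun_prop
      have hcl : IsClosed {V : testSet n | m * μ₀ / 2 ≤ ∑ k, |quadForm (x k) V.1|} :=
        isClosed_le continuous_const hcont
      have hsub : c ⊆ {V : testSet n | m * μ₀ / 2 ≤ ∑ k, |quadForm (x k) V.1|} :=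
        fun V hV => hdense ⟨V, hV⟩
      have hmem := closure_minimal hsub hcl (hcd ⟨W, hW⟩)
      simpa only [Set.mem_ofPred_eq] using hmem
    rw [hW.1.2]
    simp only [measurementOp, re_trace_ketbra_mul]
    calc (1 : ℝ) = 2 / μ₀ / m * (m * μ₀ / 2) := by field_simp
      _ ≤ _ := by gcongr

/-! ### Choice of constants and conclusion -/

/-- Since `2 * 25 ^ n ≤ 50 ^ n ≤ exp (4 n)` and `4 n ≤ κ m / 2`, the net costs half of the exponent.
-/
lemma two_mul_pow_mul_exp_le {n m : ℕ} (hn : 0 < n) {κ : ℝ} (h : 8 * (n : ℝ) ≤ κ * m) :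
    2 * 25 ^ n * Real.exp (m * -κ) ≤ Real.exp (-(κ / 2 * m)) := by
  have h1 : (2 * 25 ^ n : ℝ) ≤ Real.exp (4 * n) := by
    calc (2 * 25 ^ n : ℝ) ≤ 2 ^ n * 25 ^ n := by
          gcongr; exact le_self_pow₀ (by norm_num) hn.ne'
      _ = 50 ^ n := by rw [← mul_pow]; norm_num
      _ ≤ Real.exp 4 ^ n := by
          gcongr
          have h2 := Real.exp_one_gt_d9
          have : Real.exp 4 = Real.exp 1 ^ 4 := by rw [← Real.exp_nat_mul]; norm_num
          rw [this]
          calc (50 : ℝ) ≤ 2.718 ^ 4 := by norm_num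
            _ ≤ _ := by gcongr; linarith
      _ = _ := by rw [← Real.exp_nat_mul, mul_comm]
  calc _ ≤ Real.exp (4 * n) * Real.exp (m * -κ) := by gcongr
    _ ≤ _ := by
        rw [← Real.exp_add]
        gcongr
        linarith

end PhaseRetrieval
theorem mainTheorem4 (CI CSI CSG : ℝ) (hCI : 0 < CI) (hCSI : 0 < CSI) (hCSG : 0 < CSG) :
    ∃ C γ τ ν : ℝ, 1 < C ∧ 0 < γ ∧ 0 < τ ∧ 0 < ν ∧
      ∀ (n m : ℕ), C * (n : ℝ) ≤ (m : ℝ) →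
      ∀ (ρ : Measure (EuclideanSpace ℂ (Fin n))),
        PhaseRetrieval.Isotropic ρ CI →
        PhaseRetrieval.SubIsotropic ρ CSI →
        PhaseRetrieval.SubGaussianMoments ρ CSG →
      ∀ (Ω : Type*) [MeasurableSpace Ω] (P : Measure Ω) [IsProbabilityMeasure P]
        (a : Fin m → Ω → EuclideanSpace ℂ (Fin n)),
        (∀ k, HasLaw (a k) ρ P) → iIndepFun a P →
        1 - 3 * Real.exp (-(γ * m)) ≤
          P.real {ω |
            PhaseRetrieval.L1LowerBound τ (fun k => PhaseRetrieval.ketbra (a k ω)) ∧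
            PhaseRetrieval.FrameNearIdentity ν (fun k => PhaseRetrieval.ketbra (a k ω))} := by
  set K : ℝ := CI ^ 2 / 2 + 2 * CSG with hK
  have hK0 : 0 < K := by positivity
  set μ₀ : ℝ := CSI / (2 * √(3888 * CSG / CSI)) with hμ₀
  have hμ0 : 0 < μ₀ := by positivity
  -- In each of `s` and `l`, the first bound keeps the exponential series convergent and the second
  -- makes the quadratic term at most half of the linear gain.
  set s : ℝ := min (1 / 2) (CI / 204 / (4 * CSG)) with hs
  have hs0 : 0 < s := by positivity
  have hs1 : s ≤ 1 / 2 := min_le_left _ _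
  have hs2 : s * (4 * CSG) ≤ CI / 204 := by
    rw [← le_div_iff₀ (by positivity)]; exact min_le_right _ _
  set l : ℝ := min (1 / 408) (μ₀ / (4 * K * 204 ^ 2)) with hl
  have hl0 : 0 < l := by positivity
  have hl1 : l ≤ 1 / 408 := min_le_left _ _
  have hl2 : l * (4 * K * 204 ^ 2) ≤ μ₀ := by
    rw [← le_div_iff₀ (by positivity)]; exact min_le_right _ _
  set κ : ℝ := min (s * (CI / 204) / 2) (l * μ₀ / 4) with hκ
  have hκ0 : 0 < κ := by positivity
  have hκ1 : 2 * CSG * s ^ 2 - s * (CI / 204) ≤ -κ := by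
    have : κ ≤ s * (CI / 204) / 2 := min_le_left _ _
    have := mul_le_mul_of_nonneg_left hs2 hs0.le
    linarith
  have hκ2 : K * (204 * l) ^ 2 - l * μ₀ / 2 ≤ -κ := by
    have : κ ≤ l * μ₀ / 4 := min_le_right _ _
    have := mul_le_mul_of_nonneg_left hl2 hl0.le
    linarith
  refine ⟨1 + 8 / κ, κ / 2, 2 / μ₀, CI, by simp [hκ0], by positivity, by positivity, hCI, ?_⟩
  intro n m hnm ρ hI hSI hSG Ω _ P _ a ha hind
  -- For `n = 0` the set `D` is empty and all matrices coincide. This case is separate because `m`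
  -- may then be 0, and `ρ` inherits total mass 1 only from some `a k`.
  rcases Nat.eq_zero_or_pos n with rfl | hn
  · have huniv : {ω | PhaseRetrieval.L1LowerBound (2 / μ₀)
        (fun k => PhaseRetrieval.ketbra (a k ω)) ∧
        PhaseRetrieval.FrameNearIdentity CI (fun k => PhaseRetrieval.ketbra (a k ω))} =
        Set.univ := by
      refine Set.eq_univ_of_forall fun ω => ⟨fun Z hZ => ?_, ?_⟩
      · have h1 := hZ.1.2
        simp [PhaseRetrieval.frobNorm] at h1
      · rw [PhaseRetrieval.FrameNearIdentity, PhaseRetrieval.opNorm, Subsingleton.elim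
          (((1 / (CI * m) : ℝ) : ℂ) • ∑ k, PhaseRetrieval.ketbra (a k ω) - 1) 0]
        simp
    rw [huniv, probReal_univ]
    linarith [Real.exp_pos (-(κ / 2 * m))]
  have hn' : (0 : ℝ) < n := Nat.cast_pos.2 hn
  have h8 : 8 * (n : ℝ) ≤ κ * m := by
    calc 8 * (n : ℝ) = κ * (8 / κ * n) := by field_simp
      _ ≤ κ * ((1 + 8 / κ) * n) := by gcongr; linarith
      _ ≤ _ := by gcongr
  have hm : 0 < m := by
    have : 0 < κ * m := lt_of_lt_of_le (by positivity) h8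
    exact_mod_cast (pos_iff_pos_of_mul_pos this).1 hκ0
  have hρ : IsProbabilityMeasure ρ := (ha ⟨0, hm⟩).isProbabilityMeasure_iff.1 inferInstance
  have hlaw : P.map (fun ω k => a k ω) = Measure.pi fun _ => ρ := by
    rw [hind.map_fun_eq_pi_map fun k => (ha k).aemeasurable]
    congr 1
    funext k
    exact (ha k).map_eq
  have haem : AEMeasurable (fun ω k => a k ω) P := aemeasurable_pi_lambda _ fun k =>
    (ha k).aemeasurable
  have htransfer : ∀ B : Set (Fin m → EuclideanSpace ℂ (Fin n)),
      Measure.pi (fun _ => ρ) B ≤ ENNReal.ofReal (Real.exp (-(κ / 2 * m))) →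
      P.real {ω | (fun k => a k ω) ∈ B} ≤ Real.exp (-(κ / 2 * m)) := fun B hB =>
    ENNReal.toReal_le_of_le_ofReal (Real.exp_pos _).le
      ((Measure.le_map_apply haem B).trans (hlaw ▸ hB))
  have hfinal := PhaseRetrieval.two_mul_pow_mul_exp_le hn h8
  have h1 := htransfer _ ((PhaseRetrieval.measure_not_frameNearIdentity_le hm hCI hCSG.le hI hSG
    hs0.le hs1).trans (ENNReal.ofReal_le_ofReal (le_trans (by gcongr) hfinal)))
  have h2 := htransfer _ ((PhaseRetrieval.measure_not_l1LowerBound_le hn hm hCSG.le hI hSG hμ0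
    (fun Z hZ => PhaseRetrieval.le_integral_abs_quadForm hCSI hCSG hSI hSG hZ) hl0
    (by linarith)).trans (ENNReal.ofReal_le_ofReal (le_trans (by gcongr) hfinal)))
  have hcover : (Set.univ : Set Ω) ⊆ {ω | PhaseRetrieval.L1LowerBound (2 / μ₀)
        (fun k => PhaseRetrieval.ketbra (a k ω)) ∧
        PhaseRetrieval.FrameNearIdentity CI (fun k => PhaseRetrieval.ketbra (a k ω))} ∪
      ({ω | (fun k => a k ω) ∈ {x : Fin m → EuclideanSpace ℂ (Fin n) |
          ¬ PhaseRetrieval.FrameNearIdentity CI (fun k => PhaseRetrieval.ketbra (x k))}} ∪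
        {ω | (fun k => a k ω) ∈ {x : Fin m → EuclideanSpace ℂ (Fin n) |
          ¬ PhaseRetrieval.L1LowerBound (2 / μ₀) (fun k => PhaseRetrieval.ketbra (x k))}}) := by
    intro ω _
    simp only [Set.mem_union, Set.mem_ofPred_eq]
    tauto
  have h3 := measureReal_mono (μ := P) hcover
  rw [probReal_univ] at h3
  have h4 := (h3.trans (measureReal_union_le _ _)).trans
    (add_le_add le_rfl (measureReal_union_le _ _))
  -- The two failure events cost two exponentials; the third is slack.
  linarith [Real.exp_pos (-(κ / 2 * m))]
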